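/- Let $U\subseteq\mathbb R^3\setminus\{x_1=x_2=0\}$ be open, let $\mathbf x=(x_1,x_2,x_3)$ and $A=\mathbf x^2=x_1^2+x_2^2+x_3^2$, and let $\beta$ be a smooth real function on the set $\{\mathbf x^2:\mathbf x\in U\}$. Put $\mathbf n=(1,1,1)$ and $\mathbf f=\left(\frac{x_1}{x_1^2+x_2^2},\frac{x_2}{x_1^2+x_2^2},0\right)$. For smooth vector fields $\mathbf g$ on $U$ consider the system $$\operatorname{div}\mathbf g=2\beta'(A),\qquad \mathbf x\cdot\mathbf g=\beta(A).\qquad(*)$$ 1. If $\mathbf g=\mathbf x\times(\operatorname{grad}W+F\,\mathbf n)+\beta(A)\,\mathbf f$ on $U$, where $W$ is an arbitrary smooth function on $U$ and $F$ is an arbitrary function of the two variables $x_1+x_2+x_3$ and $\mathbf x^2$ that is smooth as a function of $\mathbf x\in U$, then $\mathbf g$ is a solution of $(*)$ on $U$. 2. $\mathbf g$ is a solution of $(*)$ on $U$ if and only if every point of $U$ has an open neighbourhood in $U$ on which $\mathbf g$ has the form in 1 for some such $W$ and $F$ (on that neighbourhood). 3. Suppose that $U$ is the set of points $(r\sin\varphi\cos\theta,\,r\sin\varphi\sin\theta,\,r\cos\varphi)$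 with $r\in I$, $\varphi\in J$, $\theta\in K$, where $I\subseteq(0,\infty)$, $J\subseteq(0,\pi)$, $K\subseteq(\alpha,\alpha+2\pi)$ are open intervals and $\alpha\in\mathbb R$ (for example, $U$ is $\mathbb R^3$ without a closed half-plane bounded by the $x_3$-axis). Then $\mathbf g$ is a solution of $(*)$ on $U$ if and only if it has the form in 1 on all of $U$ for some such $W$ and $F$. 4. Let $\mathbb R^3\times\mathbb R^3\ni(\mathbf x,\mathbf J)$ carry the Lie-Poisson bracket of $e(3)$, $\{J_i,J_j\}=\varepsilon_{ijk}J_k$, $\{J_i,x_j\}=\varepsilon_{ijk}x_k$, $\{x_i,x_j\}=0$, with Casimir functions $A=\mathbf x^2$ and $B=\mathbf x\cdot\mathbf J$. If $\mathbf g$ is a solution of $(*)$ on $U$, then the shift $\mathbf x\to\mathbf x$, $\mathbf J\to\mathbf J+\mathbf g(\mathbf x)$ is a canonical transformation of $U\times\mathbb R^3$, that is, a smooth map of $U\times\mathbb R^3$ to itself preserving the Poisson bracket of any two smooth functions. It leaves $A$ unchanged and takes $B$ to $B+\beta(A)$; for all real $a,b$ it maps the part of the level set $\{A=a,\ B=b\}$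 over $U$ bijectively onto the part of $\{A=\tilde a,\ B=\tilde b\}$ over $U$, where $\tilde a=a$, $\tilde b=b+\beta(a)$. -/

import Mathlib

open scoped ContDiff Matrix

noncomputable section

namespace E3

/-- Vectors of `ℝ³`, with components indexed by `0, 1, 2`. -/
abbrev Vec : Type := Fin 3 → ℝ

/-- The phase space of `e(3)`: pairs `(x, J)`. -/
abbrev Phase : Type := Vec × Vec

/-- The gradient of a scalar function. -/
def grad (W : Vec → ℝ) (x : Vec) : Vec := fun i => fderiv ℝ W x (Pi.single i 1)

/-- The divergence of a vector field. -/
def divergence (g : Vec → Vec) (x : Vec) : ℝ := ∑ i, fderiv ℝ g x (Pi.single i 1) i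

/-- `x² = x₁² + x₂² + x₃²`. -/
def normSq (x : Vec) : ℝ := ∑ k, x k ^ 2

/-- `x₁ + x₂ + x₃`. -/
def coordSum (x : Vec) : ℝ := ∑ k, x k

/-- The constant vector `n = (1, 1, 1)`. -/
def nVec : Vec := ![1, 1, 1]

/-- The vector field `f = (x₁, x₂, 0) / (x₁² + x₂²)`. -/
def fField (x : Vec) : Vec := ![x 0 / (x 0 ^ 2 + x 1 ^ 2), x 1 / (x 0 ^ 2 + x 1 ^ 2), 0]

/-- The complement of the third coordinate axis: the set where `f` is defined. -/
def offAxis : Set Vec := {x | x 0 ^ 2 + x 1 ^ 2 ≠ 0}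

/-- `g` is a smooth solution on `U` of `div g = 2 β'(A)`, `x · g = β(A)`, where `A = x²`. -/
def IsSolutionOn (β : ℝ → ℝ) (U : Set Vec) (g : Vec → Vec) : Prop :=
  ContDiffOn ℝ ∞ g U ∧
    ∀ x ∈ U, divergence g x = 2 * deriv β (normSq x) ∧ x ⬝ᵥ g x = β (normSq x)

/-- `g = x × (grad W + F n) + β f` on `U`, for some smooth scalar function `W` on `U` and some
function `F` of the two variables `x₁ + x₂ + x₃` and `x²`, smooth as a function of `x` on `U`. -/
def HasGeneralFormOn (β : ℝ → ℝ) (U : Set Vec) (g : Vec → Vec) : Prop :=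
  ∃ (W : Vec → ℝ) (F : ℝ → ℝ → ℝ),
    ContDiffOn ℝ ∞ W U ∧ ContDiffOn ℝ ∞ (fun x => F (coordSum x) (normSq x)) U ∧
      ∀ x ∈ U, g x =
        crossProduct x (grad W x + F (coordSum x) (normSq x) • nVec) + β (normSq x) • fField x

/-- The point with spherical coordinates `r` (radius), `φ` (polar angle, measured from the third
axis) and `θ` (azimuth). -/
def sphericalPoint (r φ θ : ℝ) : Vec :=
  ![r * Real.sin φ * Real.cos θ, r * Real.sin φ * Real.sin θ, r * Real.cos φ]

/-- A spherical box: the set of points whose spherical coordinates `r`, `φ`, `θ` range over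
open intervals `I ⊆ (0, ∞)`, `J ⊆ (0, π)` and `K ⊆ (α, α + 2π)`, for some `α`. -/
def IsSphericalBox (U : Set Vec) : Prop :=
  ∃ (I J K : Set ℝ) (α : ℝ),
    IsOpen I ∧ I.OrdConnected ∧ I ⊆ Set.Ioi 0 ∧
    IsOpen J ∧ J.OrdConnected ∧ J ⊆ Set.Ioo 0 Real.pi ∧
    IsOpen K ∧ K.OrdConnected ∧ K ⊆ Set.Ioo α (α + 2 * Real.pi) ∧
    U = {x | ∃ r ∈ I, ∃ φ ∈ J, ∃ θ ∈ K, x = sphericalPoint r φ θ}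

/-- The partial gradient `∂Φ/∂x` on the phase space. -/
def gradX (Φ : Phase → ℝ) (p : Phase) : Vec := fun i => fderiv ℝ Φ p (Pi.single i 1, 0)

/-- The partial gradient `∂Φ/∂J` on the phase space. -/
def gradJ (Φ : Phase → ℝ) (p : Phase) : Vec := fun i => fderiv ℝ Φ p (0, Pi.single i 1)

/-- The Lie-Poisson bracket of `e(3)`: the one with `{Jᵢ, Jⱼ} = εᵢⱼₖ Jₖ`, `{Jᵢ, xⱼ} = εᵢⱼₖ xₖ`,
`{xᵢ, xⱼ} = 0`. -/
def bracket (Φ Ψ : Phase → ℝ) (p : Phase) : ℝ :=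
  p.2 ⬝ᵥ crossProduct (gradJ Φ p) (gradJ Ψ p) +
    p.1 ⬝ᵥ (crossProduct (gradJ Φ p) (gradX Ψ p) + crossProduct (gradX Φ p) (gradJ Ψ p))

/-- The Casimir function `A = x²`. -/
def casimirA (p : Phase) : ℝ := normSq p.1

/-- The Casimir function `B = x · J`. -/
def casimirB (p : Phase) : ℝ := p.1 ⬝ᵥ p.2

/-- The joint level set `A = a`, `B = b` of the Casimir functions. -/
def leaf (a b : ℝ) : Set Phase := {p | casimirA p = a ∧ casimirB p = b}

/-- A canonical transformation of the (open) region `M` of the phase space: a smooth Poisson map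
from `M` to itself. -/
def IsCanonicalOn (M : Set Phase) (τ : Phase → Phase) : Prop :=
  Set.MapsTo τ M M ∧ ContDiffOn ℝ ∞ τ M ∧
    ∀ Φ Ψ : Phase → ℝ, ContDiffOn ℝ ∞ Φ M → ContDiffOn ℝ ∞ Ψ M →
      ∀ p ∈ M, bracket (Φ ∘ τ) (Ψ ∘ τ) p = bracket Φ Ψ (τ p)

/-- The shift `x → x`, `J → J + g(x)`. -/
def shift (g : Vec → Vec) (p : Phase) : Phase := (p.1, p.2 + g p.1)

end E3

end

/-!
A direct computation shows that fields of the general form are solutions: `div (x × grad W) = 0`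
because `curl grad = 0` and `curl x = 0`; `div (x × F n) = (n × x) · grad F` up to sign, which
vanishes because `F` depends only on quantities invariant under rotation about `n`
(`E3.fderiv_rotation_eq_zero`); and `f` is divergence free with `x · f = 1`, so that `β f` carries
the inhomogeneous terms (`E3.isSolutionOn_smul_fField`).

Conversely, `h = g - β f` is divergence free and tangent to the spheres centred at the origin, hence
divergence free on each sphere. On a spherical box it therefore has a stream function `W`, that is
`h = x × grad W`, which can be chosen smooth in the radius as well (`E3.exists_eq_cross_grad`). This
rests on a Poincaré lemma with parameters (`E3.exists_primitive_along`), in spherical coordinates.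
Since every point off the axis has a spherical box as a neighbourhood
(`E3.exists_isSphericalBox_subset`), this gives the local statement. The term `F n` is
redundant for existence: it only changes the choice of `W`.

For the shift, the chain rule reduces the Poisson property to the identity `(tr M - Mᵀ) x = g(x)`
with `M = Dg(x)`, in which the two equations of the system combine
(`E3.IsSolutionOn.bracket_comp_shift`).
-/

open scoped Topology

namespace E3

/-! ### Vector calculus in components -/

/-- The cross product as a continuous bilinear map. -/
noncomputable def crossL : Vec →L[ℝ] Vec →L[ℝ] Vec :=
  LinearMap.toContinuousBilinearMap crossProduct

theorem crossL_apply (u v : Vec) : crossL u v = crossProduct u v := rfl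

theorem eq_sum_single (u : Vec) :
    u = u 0 • Pi.single 0 1 + u 1 • Pi.single 1 1 + u 2 • Pi.single 2 1 := by
  ext i; fin_cases i <;> simp

theorem map_eq_sum_single {F : Type*} [NormedAddCommGroup F] [NormedSpace ℝ F]
    (L : Vec →L[ℝ] F) (u : Vec) :
    L u = u 0 • L (Pi.single 0 1) + u 1 • L (Pi.single 1 1) + u 2 • L (Pi.single 2 1) := by
  conv_lhs => rw [eq_sum_single u]
  simp only [map_add, map_smul]

theorem dotProduct_grad (W : Vec → ℝ) (x u : Vec) : grad W x ⬝ᵥ u = fderiv ℝ W x u := by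
  rw [map_eq_sum_single (fderiv ℝ W x) u]
  simp only [dotProduct, Fin.sum_univ_three, grad, smul_eq_mul]
  ring

theorem hasFDerivAt_coord (q : Vec) (i : Fin 3) :
    HasFDerivAt (fun y : Vec => y i) (ContinuousLinearMap.proj i : Vec →L[ℝ] ℝ) q :=
  (ContinuousLinearMap.proj (R := ℝ) (φ := fun _ : Fin 3 => ℝ) i).hasFDerivAt

theorem hasFDerivAt_dotProduct {E : Type*} [NormedAddCommGroup E] [NormedSpace ℝ E]
    {a b : E → Vec} {a' b' : E →L[ℝ] Vec} {x : E}
    (ha : HasFDerivAt a a' x) (hb : HasFDerivAt b b' x) :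
    ∃ L : E →L[ℝ] ℝ, HasFDerivAt (fun y => a y ⬝ᵥ b y) L x ∧
      ∀ u, L u = a' u ⬝ᵥ b x + a x ⬝ᵥ b' u := by
  have ha' := hasFDerivAt_pi'.1 ha
  have hb' := hasFDerivAt_pi'.1 hb
  refine ⟨_, HasFDerivAt.fun_sum (u := Finset.univ) fun i _ => (ha' i).mul (hb' i), fun u => ?_⟩
  simp [dotProduct, Fin.sum_univ_three]
  ring

theorem contDiff_normSq : ContDiff ℝ ∞ normSq := by
  unfold normSq; fun_prop

theorem hasFDerivAt_normSq (x : Vec) :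
    ∃ L : Vec →L[ℝ] ℝ, HasFDerivAt normSq L x ∧ ∀ u, L u = 2 * (x ⬝ᵥ u) := by
  obtain ⟨L, hL, hL'⟩ := hasFDerivAt_dotProduct (hasFDerivAt_id x) (hasFDerivAt_id x)
  refine ⟨L, ?_, fun u => ?_⟩
  · have : normSq = fun y => id y ⬝ᵥ id y := by
      funext y; simp [normSq, dotProduct, sq]
    rwa [this]
  · rw [hL']; simp [dotProduct_comm x u]; ring

theorem normSq_eq (x : Vec) : normSq x = x 0 ^ 2 + x 1 ^ 2 + x 2 ^ 2 := by
  simp [normSq, Fin.sum_univ_three]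

theorem isOpen_offAxis : IsOpen offAxis := by
  unfold offAxis
  exact isOpen_ne_fun (by fun_prop) (by fun_prop)

theorem normSq_pos {x : Vec} (hx : x ∈ offAxis) : 0 < normSq x := by
  have h : x 0 ^ 2 + x 1 ^ 2 ≠ 0 := hx
  have : 0 < x 0 ^ 2 + x 1 ^ 2 := lt_of_le_of_ne (by positivity) h.symm
  rw [normSq_eq]; positivity

/-- The squared norm is open at every point other than the origin, because rescaling a point moves
its squared norm through a neighbourhood. -/
theorem image_normSq_mem_nhds {U : Set Vec} (hU : IsOpen U) {x : Vec} (hx : x ∈ U)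
    (hA : 0 < normSq x) : normSq '' U ∈ 𝓝 (normSq x) := by
  have hc : ContinuousAt (fun t : ℝ => Real.sqrt (t / normSq x) • x) (normSq x) := by fun_prop
  have h1 : Real.sqrt (normSq x / normSq x) • x = x := by rw [div_self hA.ne']; simp
  have := hc.preimage_mem_nhds (t := U) (by rw [h1]; exact hU.mem_nhds hx)
  filter_upwards [this, Ioi_mem_nhds hA] with t ht ht0
  refine ⟨_, ht, ?_⟩
  have h2 : Real.sqrt (t / normSq x) ^ 2 = t / normSq x :=
    Real.sq_sqrt (div_nonneg (le_of_lt ht0) hA.le)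
  have h3 : normSq (Real.sqrt (t / normSq x) • x) = Real.sqrt (t / normSq x) ^ 2 * normSq x := by
    simp [normSq_eq]; ring
  rw [h3, h2, div_mul_cancel₀ _ hA.ne']

theorem divergence_eq {g : Vec → Vec} {g' : Vec →L[ℝ] Vec} {x : Vec} (h : HasFDerivAt g g' x) :
    divergence g x = ∑ i, g' (Pi.single i 1) i := by
  rw [divergence, h.fderiv]

theorem divergence_add {g h : Vec → Vec} {x : Vec} (hg : DifferentiableAt ℝ g x)
    (hh : DifferentiableAt ℝ h x) :
    divergence (fun y => g y + h y) x = divergence g x + divergence h x := by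
  rw [divergence_eq (hg.hasFDerivAt.fun_add hh.hasFDerivAt)]
  simp [divergence, Finset.sum_add_distrib]

theorem divergence_sub {g h : Vec → Vec} {x : Vec} (hg : DifferentiableAt ℝ g x)
    (hh : DifferentiableAt ℝ h x) :
    divergence (fun y => g y - h y) x = divergence g x - divergence h x := by
  rw [divergence_eq (hg.hasFDerivAt.fun_sub hh.hasFDerivAt)]
  simp [divergence, Finset.sum_sub_distrib]

theorem divergence_congr {g h : Vec → Vec} {x : Vec} (hgh : g =ᶠ[𝓝 x] h) :
    divergence g x = divergence h x := by
  rw [divergence, divergence, hgh.fderiv_eq]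

/-- `div (x × v) = - x · curl v`. -/
theorem divergence_cross {v : Vec → Vec} {M : Vec →L[ℝ] Vec} {x : Vec} (h : HasFDerivAt v M x) :
    divergence (fun y => crossProduct y (v y)) x =
      x 0 * (M (Pi.single 2 1) 1 - M (Pi.single 1 1) 2) +
      x 1 * (M (Pi.single 0 1) 2 - M (Pi.single 2 1) 0) +
      x 2 * (M (Pi.single 1 1) 0 - M (Pi.single 0 1) 1) := by
  have := crossL.hasFDerivAt_of_bilinear (hasFDerivAt_id x) h
  simp only [crossL_apply, id] at this
  rw [divergence_eq this]
  simp [Fin.sum_univ_three, crossL_apply, cross_apply]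
  ring

theorem contDiffOn_cross {E : Type*} [NormedAddCommGroup E] [NormedSpace ℝ E] {s : Set E}
    {a b : E → Vec} (ha : ContDiffOn ℝ ∞ a s) (hb : ContDiffOn ℝ ∞ b s) :
    ContDiffOn ℝ ∞ (fun y => crossProduct (a y) (b y)) s :=
  (crossL.contDiff.comp_contDiffOn ha).clm_apply hb

theorem contDiffOn_grad {U : Set Vec} (hU : IsOpen U) {W : Vec → ℝ} (hW : ContDiffOn ℝ ∞ W U) :
    ContDiffOn ℝ ∞ (grad W) U :=
  contDiffOn_pi.2 fun _ => (hW.fderiv_of_isOpen hU le_rfl).clm_apply contDiffOn_const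

/-- `div (x × grad W) = 0`, by the symmetry of second derivatives. -/
theorem divergence_cross_grad {U : Set Vec} (hU : IsOpen U) {W : Vec → ℝ}
    (hW : ContDiffOn ℝ ∞ W U) {x : Vec} (hx : x ∈ U) :
    divergence (fun y => crossProduct y (grad W y)) x = 0 := by
  have hWx : ContDiffAt ℝ ∞ W x := hW.contDiffAt (hU.mem_nhds hx)
  have hd : DifferentiableAt ℝ (grad W) x :=
    ((contDiffOn_grad hU hW).contDiffAt (hU.mem_nhds hx)).differentiableAt (by simp)
  have hd2 : DifferentiableAt ℝ (fderiv ℝ W) x :=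
    (((hW.fderiv_of_isOpen hU (m := ∞) le_rfl)).contDiffAt (hU.mem_nhds hx)).differentiableAt
      (by simp)
  have key (i j : Fin 3) : fderiv ℝ (grad W) x (Pi.single i 1) j =
      fderiv ℝ (fderiv ℝ W) x (Pi.single i 1) (Pi.single j 1) := by
    have h1 := hasFDerivAt_pi'.1 hd.hasFDerivAt j
    have h2 := hd2.hasFDerivAt.clm_apply (hasFDerivAt_const (Pi.single j (1 : ℝ) : Vec) x)
    have := h1.unique h2
    simpa using congrArg (fun L => L (Pi.single i 1)) this
  have hs : IsSymmSndFDerivAt ℝ W x := hWx.isSymmSndFDerivAt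
    (by simpa using ENat.LEInfty.out)
  rw [divergence_cross hd.hasFDerivAt]
  simp only [key]
  rw [hs.eq (Pi.single 2 1) (Pi.single 1 1), hs.eq (Pi.single 2 1) (Pi.single 0 1),
    hs.eq (Pi.single 1 1) (Pi.single 0 1)]
  ring

/-- A function of `x₁ + x₂ + x₃` and `x²` has vanishing derivative in the direction `n × x`,
since both variables are constant along the rotation of `x` about the axis through `n`.
No regularity of the function of two variables is needed. -/
theorem fderiv_rotation_eq_zero {F : ℝ → ℝ → ℝ} {x : Vec} {L : Vec →L[ℝ] ℝ}
    (h : HasFDerivAt (fun x => F (coordSum x) (normSq x)) L x) :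
    L (crossProduct nVec x) = 0 := by
  set m : Vec := (coordSum x / 3) • nVec with hm
  set w : Vec := crossProduct nVec x with hw
  set k : ℝ := (Real.sqrt 3)⁻¹ with hk
  have hk2 : k ^ 2 = 1 / 3 := by rw [hk, inv_pow, Real.sq_sqrt (by norm_num)]; norm_num
  have hk0 : k ≠ 0 := by positivity
  let c : ℝ → Vec := fun t => m + Real.cos t • (x - m) + (Real.sin t * k) • w
  have hc0 : c 0 = x := by simp [c]
  have hc : HasDerivAt c (k • w) 0 := by
    have h1 := (((Real.hasDerivAt_cos 0).smul_const (x - m)).const_add m).fun_add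
      (((Real.hasDerivAt_sin 0).mul_const k).smul_const w)
    have h2 : k • w = -Real.sin 0 • (x - m) + (Real.cos 0 * k) • w := by simp
    rw [h2]
    exact h1
  have hconst : ∀ t, coordSum (c t) = coordSum x ∧ normSq (c t) = normSq x := by
    intro t
    have hcs := Real.sin_sq_add_cos_sq t
    constructor
    · simp only [c, coordSum, hm, hw, Fin.sum_univ_three, nVec, cross_apply,
        Pi.add_apply, Pi.smul_apply, Pi.sub_apply, smul_eq_mul, Matrix.cons_val]
      ring
    · simp only [normSq_eq, c, coordSum, hm, hw, Fin.sum_univ_three, nVec, cross_apply,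
        Pi.add_apply, Pi.smul_apply, Pi.sub_apply, smul_eq_mul, Matrix.cons_val]
      generalize Real.sin t = S at *
      generalize Real.cos t = C at *
      linear_combination (S ^ 2 * ((x 2 - x 1) ^ 2 + (x 0 - x 2) ^ 2 + (x 1 - x 0) ^ 2)) * hk2 +
        (((x 2 - x 1) ^ 2 + (x 0 - x 2) ^ 2 + (x 1 - x 0) ^ 2) / 3) * hcs
  have h1 : HasDerivAt (fun t => F (coordSum (c t)) (normSq (c t))) (L (k • w)) 0 :=
    
    HasFDerivAt.comp_hasDerivAt (l := fun x => F (coordSum x) (normSq x)) (f := c) (0 : ℝ)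
      (by rw [hc0]; exact h) hc
  have h2 : HasDerivAt (fun t => F (coordSum (c t)) (normSq (c t))) 0 0 := by
    simp only [hconst]
    exact hasDerivAt_const _ _
  have := h1.unique h2
  simpa [hk0] using this

theorem divergence_cross_smul_nVec {F : ℝ → ℝ → ℝ} {x : Vec}
    (h : DifferentiableAt ℝ (fun x => F (coordSum x) (normSq x)) x) :
    divergence (fun y => crossProduct y (F (coordSum y) (normSq y) • nVec)) x = 0 := by
  have h0 := fderiv_rotation_eq_zero h.hasFDerivAt
  rw [divergence_cross (h.hasFDerivAt.smul_const nVec)]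
  rw [map_eq_sum_single] at h0
  simp [nVec, cross_apply] at h0 ⊢
  linear_combination -h0

theorem contDiffOn_fField : ContDiffOn ℝ ∞ fField offAxis := by
  refine contDiffOn_pi.2 fun i => ?_
  have h : ∀ x ∈ offAxis, x 0 ^ 2 + x 1 ^ 2 ≠ 0 := fun x hx => hx
  have hd : ContDiffOn ℝ ∞ (fun x : Vec => x 0 ^ 2 + x 1 ^ 2) offAxis := by fun_prop
  fin_cases i
  · exact ContDiffOn.div (by fun_prop) hd h
  · exact ContDiffOn.div (by fun_prop) hd h
  · exact contDiffOn_const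

theorem dotProduct_fField {x : Vec} (hx : x ∈ offAxis) : x ⬝ᵥ fField x = 1 := by
  have h : x 0 ^ 2 + x 1 ^ 2 ≠ 0 := hx
  simp [dotProduct, Fin.sum_univ_three, fField]
  field_simp

theorem divergence_fField {x : Vec} (hx : x ∈ offAxis) : divergence fField x = 0 := by
  have h : x 0 ^ 2 + x 1 ^ 2 ≠ 0 := hx
  have hd : DifferentiableAt ℝ fField x :=
    (contDiffOn_fField.contDiffAt (isOpen_offAxis.mem_nhds hx)).differentiableAt (by simp)
  have hp := hasFDerivAt_coord x
  have hden := ((hp 0).pow 2).add ((hp 1).pow 2)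
  have hinv := (hasDerivAt_inv h).comp_hasFDerivAt x hden
  have h0 := (hp 0).mul hinv
  have h1 := (hp 1).mul hinv
  have e0 := (hasFDerivAt_pi'.1 hd.hasFDerivAt 0).unique h0
  have e1 := (hasFDerivAt_pi'.1 hd.hasFDerivAt 1).unique h1
  have e2 := (hasFDerivAt_pi'.1 hd.hasFDerivAt 2).unique (hasFDerivAt_const (0 : ℝ) x)
  have e0' := congrArg (fun L => L (Pi.single 0 1)) e0
  have e1' := congrArg (fun L => L (Pi.single 1 1)) e1
  have e2' := congrArg (fun L => L (Pi.single 2 1)) e2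
  simp at e0' e1' e2'
  simp only [divergence, Fin.sum_univ_three, e0', e1', e2']
  field_simp
  ring

/-! ### The fields of the general form are solutions -/

section

variable {U : Set Vec} {β : ℝ → ℝ}

theorem contDiffOn_comp_normSq (hβ : ContDiffOn ℝ ∞ β (normSq '' U)) :
    ContDiffOn ℝ ∞ (fun x => β (normSq x)) U :=
  hβ.comp contDiff_normSq.contDiffOn (Set.mapsTo_image _ _)

theorem hasFDerivAt_comp_normSq (hU : IsOpen U) (hUa : U ⊆ offAxis)
    (hβ : ContDiffOn ℝ ∞ β (normSq '' U)) {x : Vec} (hx : x ∈ U) :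
    ∃ L : Vec →L[ℝ] ℝ, HasFDerivAt (fun x => β (normSq x)) L x ∧
      ∀ u, L u = 2 * deriv β (normSq x) * (x ⬝ᵥ u) := by
  obtain ⟨L, hL, hL'⟩ := hasFDerivAt_normSq x
  have hd : DifferentiableAt ℝ β (normSq x) :=
    (hβ.contDiffAt (image_normSq_mem_nhds hU hx (normSq_pos (hUa hx)))).differentiableAt (by simp)
  refine ⟨_, hd.hasDerivAt.comp_hasFDerivAt x hL, fun u => ?_⟩
  simp [hL']; ring

theorem isSolutionOn_smul_fField (hU : IsOpen U) (hUa : U ⊆ offAxis)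
    (hβ : ContDiffOn ℝ ∞ β (normSq '' U)) :
    IsSolutionOn β U (fun x => β (normSq x) • fField x) := by
  refine ⟨(contDiffOn_comp_normSq hβ).smul (contDiffOn_fField.mono hUa), fun x hx => ⟨?_, ?_⟩⟩
  · obtain ⟨L, hL, hL'⟩ := hasFDerivAt_comp_normSq hU hUa hβ hx
    have hd : DifferentiableAt ℝ fField x :=
      (contDiffOn_fField.contDiffAt (isOpen_offAxis.mem_nhds (hUa hx))).differentiableAt (by simp)
    have h0 := divergence_fField (hUa hx)
    have h1 := dotProduct_fField (hUa hx)
    rw [divergence_eq (hL.fun_smul hd.hasFDerivAt)]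
    simp [divergence, Fin.sum_univ_three, hL', dotProduct] at h0 h1 ⊢
    linear_combination β (normSq x) * h0 + 2 * deriv β (normSq x) * h1
  · rw [dotProduct_smul, dotProduct_fField (hUa hx)]; simp

theorem isSolutionOn_of_hasGeneralFormOn (hU : IsOpen U) (hUa : U ⊆ offAxis)
    (hβ : ContDiffOn ℝ ∞ β (normSq '' U)) {g : Vec → Vec} (hg : HasGeneralFormOn β U g) :
    IsSolutionOn β U g := by
  obtain ⟨W, F, hW, hF, hg⟩ := hg
  obtain ⟨hf1, hf2⟩ := isSolutionOn_smul_fField hU hUa hβ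
  have hgW := contDiffOn_cross (contDiffOn_id (s := U)) (contDiffOn_grad hU hW)
  have hgF := contDiffOn_cross (contDiffOn_id (s := U)) (hF.smul_const nVec)
  simp only [id] at hgW hgF
  have hg' : ∀ x ∈ U, g x = crossProduct x (grad W x) +
      crossProduct x (F (coordSum x) (normSq x) • nVec) + β (normSq x) • fField x := by
    intro x hx; rw [hg x hx, map_add]
  refine ⟨((hgW.add hgF).add hf1).congr hg', fun x hx => ⟨?_, ?_⟩⟩
  · have hn := hU.mem_nhds hx
    have d1 := (hgW.contDiffAt hn).differentiableAt (by simp)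
    have d2 := (hgF.contDiffAt hn).differentiableAt (by simp)
    have d3 := (hf1.contDiffAt hn).differentiableAt (by simp)
    rw [divergence_congr (Filter.eventuallyEq_of_mem hn hg'), divergence_add (d1.fun_add d2) d3,
      divergence_add d1 d2, divergence_cross_grad hU hW hx,
      divergence_cross_smul_nVec ((hF.contDiffAt hn).differentiableAt (by simp)), (hf2 x hx).1]
    ring
  · rw [hg' x hx, dotProduct_add, dotProduct_add, (hf2 x hx).2, dot_self_cross, dot_self_cross]
    ring

/-- The derivative of the equation `x · g = β(A)`. -/
theorem IsSolutionOn.dotProduct_fderiv {g : Vec → Vec} (hg : IsSolutionOn β U g) (hU : IsOpen U)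
    (hUa : U ⊆ offAxis) (hβ : ContDiffOn ℝ ∞ β (normSq '' U)) {x : Vec} (hx : x ∈ U) (u : Vec) :
    u ⬝ᵥ g x + x ⬝ᵥ fderiv ℝ g x u = 2 * deriv β (normSq x) * (x ⬝ᵥ u) := by
  have hn := hU.mem_nhds hx
  have hd := (hg.1.contDiffAt hn).differentiableAt (by simp)
  obtain ⟨L, hL, hL'⟩ := hasFDerivAt_comp_normSq hU hUa hβ hx
  obtain ⟨N, hN, hN'⟩ := hasFDerivAt_dotProduct (hasFDerivAt_id x) hd.hasFDerivAt
  have he : (fun y => y ⬝ᵥ g y) =ᶠ[𝓝 x] fun y => β (normSq y) :=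
    Filter.eventuallyEq_of_mem hn fun y hy => (hg.2 y hy).2
  have := (hN.congr_of_eventuallyEq he.symm).unique hL
  rw [← hL', ← this, hN']
  simp

/-- Subtracting the particular solution `β f` leaves a solution of the homogeneous system. -/
theorem IsSolutionOn.sub_smul_fField {g : Vec → Vec} (hg : IsSolutionOn β U g) (hU : IsOpen U)
    (hUa : U ⊆ offAxis) (hβ : ContDiffOn ℝ ∞ β (normSq '' U)) :
    IsSolutionOn 0 U (fun x => g x - β (normSq x) • fField x) := by
  obtain ⟨hf1, hf2⟩ := isSolutionOn_smul_fField hU hUa hβ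
  refine ⟨hg.1.sub hf1, fun x hx => ⟨?_, ?_⟩⟩
  · have hn := hU.mem_nhds hx
    rw [divergence_sub ((hg.1.contDiffAt hn).differentiableAt (by simp))
      ((hf1.contDiffAt hn).differentiableAt (by simp)), (hg.2 x hx).1, (hf2 x hx).1]
    simp
  · rw [dotProduct_sub, (hg.2 x hx).2, (hf2 x hx).2]
    simp

end

/-! ### Smoothness of integrals depending on a parameter -/

section ParametricIntegral

variable {E : Type} [NormedAddCommGroup E] [NormedSpace ℝ E]

theorem hasFDerivAt_integral_of_contDiffOn {F : Type} [NormedAddCommGroup F] [NormedSpace ℝ F]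
    {S : Set (E × ℝ)} (hS : IsOpen S) {G : E × ℝ → F} (hG : ContDiffOn ℝ ∞ G S)
    {x : E} (hx : ∀ t ∈ Set.Icc (0 : ℝ) 1, (x, t) ∈ S) :
    HasFDerivAt (fun y => ∫ t in (0 : ℝ)..1, G (y, t))
      (∫ t in (0 : ℝ)..1, (fderiv ℝ G (x, t)).comp (ContinuousLinearMap.inl ℝ E ℝ)) x := by
  set G' : E × ℝ → E →L[ℝ] F := fun p => (fderiv ℝ G p).comp (ContinuousLinearMap.inl ℝ E ℝ)
    with hG'
  have hGc : ContinuousOn G S := hG.continuousOn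
  have hG'c : ContinuousOn G' S :=
    (hG.continuousOn_fderiv_of_isOpen hS (by simp)).clm_comp continuousOn_const
  have hline (y : E) : Continuous fun t : ℝ => (y, t) := by fun_prop
  -- a uniform bound for `G'` on the segment over `x`, then on a tube around it
  obtain ⟨C, hC⟩ := isCompact_Icc.exists_bound_of_continuousOn
    (hG'c.comp (hline x).continuousOn hx)
  have hT : IsOpen (S ∩ (fun p => ‖G' p‖) ⁻¹' Set.Iio (C + 1)) :=
    hG'c.norm.isOpen_inter_preimage hS isOpen_Iio
  obtain ⟨u, v, hu, -, hxu, hv, huv⟩ := generalized_tube_lemma (isCompact_singleton (x := x))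
    (isCompact_Icc (a := (0 : ℝ)) (b := 1)) hT (by
      rintro ⟨y, t⟩ ⟨rfl, ht⟩
      exact ⟨hx t ht, (hC t ht).trans_lt (lt_add_one C)⟩)
  have hux : u ∈ 𝓝 x := hu.mem_nhds (hxu rfl)
  have hmem : ∀ y ∈ u, ∀ t ∈ Set.Icc (0 : ℝ) 1, (y, t) ∈ S ∧ ‖G' (y, t)‖ < C + 1 :=
    fun y hy t ht => huv ⟨hy, hv ht⟩
  have hI : Set.uIoc (0 : ℝ) 1 ⊆ Set.Icc 0 1 := by
    rw [Set.uIoc_of_le zero_le_one]; exact Set.Ioc_subset_Icc_self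
  have hcont : ∀ y ∈ u, ContinuousOn (fun t => G (y, t)) (Set.Icc 0 1) := fun y hy =>
    hGc.comp (hline y).continuousOn fun t ht => (hmem y hy t ht).1
  have hcont' : ContinuousOn (fun t => G' (x, t)) (Set.Icc 0 1) :=
    hG'c.comp (hline x).continuousOn hx
  refine intervalIntegral.hasFDerivAt_integral_of_dominated_of_fderiv_le
    (F := fun y t => G (y, t)) (F' := fun y t => G' (y, t)) (bound := fun _ => C + 1) hux
    ?_ ?_ ?_ ?_ ?_ ?_
  · filter_upwards [hux] with y hy
    exact ((hcont y hy).aestronglyMeasurable measurableSet_Icc).mono_set hI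
  · exact ContinuousOn.intervalIntegrable
      (by rw [Set.uIcc_of_le zero_le_one]; exact hcont x (hxu rfl))
  · exact (hcont'.aestronglyMeasurable measurableSet_Icc).mono_set hI
  · exact .of_forall fun t ht y hy => (hmem y hy t (hI ht)).2.le
  · exact intervalIntegrable_const
  · refine .of_forall fun t ht y hy => ?_
    have hd : DifferentiableAt ℝ G (y, t) :=
      (hG.contDiffAt (hS.mem_nhds (hmem y hy t (hI ht)).1)).differentiableAt (by simp)
    exact hd.hasFDerivAt.comp y (hasFDerivAt_prodMk_left y t)

/-- An integral over `[0, 1]` of a smooth function depends smoothly on a parameter. -/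
theorem contDiffOn_integral {F : Type} [NormedAddCommGroup F] [NormedSpace ℝ F]
    {S : Set (E × ℝ)} (hS : IsOpen S) {G : E × ℝ → F} (hG : ContDiffOn ℝ ∞ G S)
    {V : Set E} (hV : IsOpen V) (hVS : ∀ x ∈ V, ∀ t ∈ Set.Icc (0 : ℝ) 1, (x, t) ∈ S) :
    ContDiffOn ℝ ∞ (fun y => ∫ t in (0 : ℝ)..1, G (y, t)) V := by
  rw [contDiffOn_infty]
  intro n
  induction n generalizing F with
  | zero =>
    simp only [Nat.cast_zero, contDiffOn_zero]
    exact fun x hx =>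
      (hasFDerivAt_integral_of_contDiffOn hS hG (hVS x hx)).continuousAt.continuousWithinAt
  | succ n ih =>
    have hd : ∀ x ∈ V, HasFDerivAt (fun y => ∫ t in (0 : ℝ)..1, G (y, t)) _ x := fun x hx =>
      hasFDerivAt_integral_of_contDiffOn hS hG (hVS x hx)
    rw [Nat.cast_add, Nat.cast_one, contDiffOn_succ_iff_fderiv_of_isOpen hV]
    refine ⟨fun x hx => (hd x hx).differentiableAt.differentiableWithinAt, by simp, ?_⟩
    refine (ih (G := fun p => (fderiv ℝ G p).comp (ContinuousLinearMap.inl ℝ E ℝ)) ?_).congr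
      fun x hx => (hd x hx).fderiv
    exact (hG.fderiv_of_isOpen hS (by simp)).clm_comp contDiffOn_const

end ParametricIntegral

/-! ### The Poincaré lemma with parameters -/

/-- The Poincaré lemma for `1`-forms, with parameters. The projection `L` splits off the directions
in which the form `η` is closed and is to be integrated; the complementary directions play the
role of parameters, on which the primitive depends smoothly. The primitive at `x` is the integral
of `η` over the segment from `x - L (x - q)` to `x`. -/
theorem exists_primitive_along {E : Type} [NormedAddCommGroup E] [NormedSpace ℝ E]
    {Ω : Set E} (hΩ : IsOpen Ω) (hconv : Convex ℝ Ω) (L : E →L[ℝ] E) (hL : ∀ u, L (L u) = L u)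
    (q : E) (hq : ∀ x ∈ Ω, x - L (x - q) ∈ Ω) {η : E → E →L[ℝ] ℝ} (hη : ContDiffOn ℝ ∞ η Ω)
    (hclosed : ∀ x ∈ Ω, ∀ u v, fderiv ℝ η x (L u) (L v) = fderiv ℝ η x (L v) (L u)) :
    ∃ Ψ : E → ℝ, ContDiffOn ℝ ∞ Ψ Ω ∧ ∀ x ∈ Ω, ∀ u, fderiv ℝ Ψ x (L u) = η x (L u) := by
  let seg : E × ℝ → E := fun p => p.1 - (1 - p.2) • L (p.1 - q)
  have hseg : ContDiff ℝ ∞ seg := by fun_prop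
  set S := seg ⁻¹' Ω with hS_def
  have hS : IsOpen S := hΩ.preimage hseg.continuous
  have hsegmem : ∀ x ∈ Ω, ∀ t ∈ Set.Icc (0 : ℝ) 1, (x, t) ∈ S := by
    intro x hx t ht
    have := hconv (hq x hx) hx (sub_nonneg.2 ht.2) ht.1 (by ring)
    have he : seg (x, t) = (1 - t) • (x - L (x - q)) + t • x := by simp only [seg]; module
    rwa [hS_def, Set.mem_preimage, he]
  let G : E × ℝ → ℝ := fun p => η (seg p) (L (p.1 - q))
  have hG : ContDiffOn ℝ ∞ G S :=
    (hη.comp hseg.contDiffOn fun p hp => hp).clm_apply (by fun_prop)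
  refine ⟨fun y => ∫ t in (0 : ℝ)..1, G (y, t), contDiffOn_integral hS hG hΩ hsegmem,
    fun x hx u => ?_⟩
  have hηd : ∀ t ∈ Set.Icc (0 : ℝ) 1, HasFDerivAt η (fderiv ℝ η (seg (x, t))) (seg (x, t)) :=
    fun t ht => ((hη.contDiffAt (hΩ.mem_nhds (hsegmem x hx t ht))).differentiableAt
      (by simp)).hasFDerivAt
  -- along the segment, the derivative of the integrand is a total derivative
  have hderiv : ∀ t ∈ Set.Icc (0 : ℝ) 1,
      HasDerivAt (fun t => t * η (seg (x, t)) (L u)) (fderiv ℝ G (x, t) (L u, 0)) t := by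
    intro t ht
    have hs2 : HasDerivAt (fun t => seg (x, t)) (L (x - q)) t := by
      have := (((hasDerivAt_id t).const_sub 1).smul_const (L (x - q))).const_sub x
      simpa [seg] using this
    have h1 : HasDerivAt (fun t => t * η (seg (x, t)) (L u))
        (1 * η (seg (x, t)) (L u) + t * fderiv ℝ η (seg (x, t)) (L (x - q)) (L u)) t := by
      have ha : HasDerivAt (fun t => η (seg (x, t))) (fderiv ℝ η (seg (x, t)) (L (x - q))) t :=
        HasFDerivAt.comp_hasDerivAt (l := η) (f := fun t => seg (x, t)) t (hηd t ht) hs2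
      have hb := ha.clm_apply (hasDerivAt_const t (L u))
      simpa using (hasDerivAt_id' t).fun_mul hb
    have hl : HasFDerivAt (fun y => L (y - q)) L x := by
      simpa using (L.hasFDerivAt (x := x)).sub_const (L q)
    have hs1 : HasFDerivAt (fun y => seg (y, t))
        (ContinuousLinearMap.id ℝ E - (1 - t) • L) x := by
      exact (hasFDerivAt_id x).fun_sub (hl.fun_const_smul (1 - t))
    have hGd : DifferentiableAt ℝ G (x, t) :=
      (hG.contDiffAt (hS.mem_nhds (hsegmem x hx t ht))).differentiableAt (by simp)
    have h3 : HasFDerivAt (fun y => G (y, t))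
        ((fderiv ℝ G (x, t)).comp (ContinuousLinearMap.inl ℝ E ℝ)) x :=
      HasFDerivAt.comp (g := G) x hGd.hasFDerivAt (hasFDerivAt_prodMk_left x t)
    have ha : HasFDerivAt (fun y => η (seg (y, t)))
        ((fderiv ℝ η (seg (x, t))).comp (ContinuousLinearMap.id ℝ E - (1 - t) • L)) x :=
      HasFDerivAt.comp (g := η) (f := fun y => seg (y, t)) x (hηd t ht) hs1
    have h2 := ha.clm_apply hl
    have h4 := congrArg (fun N => N (L u)) (h3.unique h2)
    have h5 := hclosed _ (hsegmem x hx t ht) u (x - q)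
    convert h1 using 1
    simp [hL, -map_sub] at h4 ⊢
    rw [h4, h5]
    ring
  have hint := hasFDerivAt_integral_of_contDiffOn hS hG (hsegmem x hx)
  have hcont : ContinuousOn (fun t => (fderiv ℝ G (x, t)).comp (ContinuousLinearMap.inl ℝ E ℝ))
      (Set.uIcc 0 1) := by
    rw [Set.uIcc_of_le zero_le_one]
    exact (((hG.continuousOn_fderiv_of_isOpen hS (by simp)).comp
      (Continuous.continuousOn (by fun_prop)) (hsegmem x hx)).clm_comp continuousOn_const)
  have hsegone : seg (x, 1) = x := by simp [seg]
  rw [hint.fderiv, ContinuousLinearMap.intervalIntegral_apply hcont.intervalIntegrable]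
  have := intervalIntegral.integral_eq_sub_of_hasDerivAt
    (fun t ht => hderiv t (by rwa [Set.uIcc_of_le zero_le_one] at ht))
    (ContinuousOn.intervalIntegrable (hcont.clm_apply (continuousOn_const (c := L u))))
  simpa [hsegone] using this

/-! ### Spherical coordinates -/

/-- The spherical parametrization, as a map of the vector `(r, φ, θ)`. -/
noncomputable def sph (q : Vec) : Vec := sphericalPoint (q 0) (q 1) (q 2)

/-- The radial unit vector of the spherical frame at `(r, φ, θ)`. -/
noncomputable def rHat (q : Vec) : Vec :=
  ![Real.sin (q 1) * Real.cos (q 2), Real.sin (q 1) * Real.sin (q 2), Real.cos (q 1)]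

/-- The polar unit vector of the spherical frame at `(r, φ, θ)`. -/
noncomputable def phiHat (q : Vec) : Vec :=
  ![Real.cos (q 1) * Real.cos (q 2), Real.cos (q 1) * Real.sin (q 2), -Real.sin (q 1)]

/-- The azimuthal unit vector of the spherical frame at `(r, φ, θ)`. -/
noncomputable def thetaHat (q : Vec) : Vec := ![-Real.sin (q 2), Real.cos (q 2), 0]

theorem sph_eq (q : Vec) : sph q = q 0 • rHat q := by
  ext i; fin_cases i <;> simp [sph, sphericalPoint, rHat, mul_assoc]

theorem contDiff_sph : ContDiff ℝ ∞ sph := by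
  refine contDiff_pi.2 fun i => ?_
  fin_cases i <;> simp [sph, sphericalPoint] <;> fun_prop

theorem contDiff_phiHat : ContDiff ℝ ∞ phiHat := by
  refine contDiff_pi.2 fun i => ?_
  fin_cases i <;> simp [phiHat] <;> fun_prop

theorem contDiff_thetaHat : ContDiff ℝ ∞ thetaHat := by
  refine contDiff_pi.2 fun i => ?_
  fin_cases i <;> simp [thetaHat] <;> fun_prop

theorem fderiv_sph (q u : Vec) :
    fderiv ℝ sph q u = u 0 • rHat q + (q 0 * u 1) • phiHat q +
      (q 0 * Real.sin (q 1) * u 2) • thetaHat q := by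
  have h := hasFDerivAt_pi'.1 (contDiff_sph.differentiable (by simp) q).hasFDerivAt
  have hp := hasFDerivAt_coord q
  ext i
  fin_cases i
  · have := congrArg (fun L => L u) ((h 0).unique (((hp 0).mul (hp 1).sin).mul (hp 2).cos))
    simp at this
    simp [this, rHat, phiHat, thetaHat]; ring
  · have := congrArg (fun L => L u) ((h 1).unique (((hp 0).mul (hp 1).sin).mul (hp 2).sin))
    simp at this
    simp [this, rHat, phiHat, thetaHat]; ring
  · have := congrArg (fun L => L u) ((h 2).unique ((hp 0).mul (hp 1).cos))
    simp at this
    simp [this, rHat, phiHat, thetaHat]; ring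

theorem fderiv_phiHat_single_one (q : Vec) : fderiv ℝ phiHat q (Pi.single 1 1) = -rHat q := by
  have h := hasFDerivAt_pi'.1 (contDiff_phiHat.differentiable (by simp) q).hasFDerivAt
  have hp := hasFDerivAt_coord q
  ext i
  fin_cases i
  · have := congrArg (fun L => L (Pi.single 1 1)) ((h 0).unique ((hp 1).cos.mul (hp 2).cos))
    simp at this
    simp [this, rHat]; ring
  · have := congrArg (fun L => L (Pi.single 1 1)) ((h 1).unique ((hp 1).cos.mul (hp 2).sin))
    simp at this
    simp [this, rHat]; ring
  · have := congrArg (fun L => L (Pi.single 1 1)) ((h 2).unique (hp 1).sin.neg)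
    simp at this
    simp [this, rHat]

theorem fderiv_thetaHat_single_two (q : Vec) : fderiv ℝ thetaHat q (Pi.single 2 1) =
    -(Real.sin (q 1) • rHat q + Real.cos (q 1) • phiHat q) := by
  have h := hasFDerivAt_pi'.1 (contDiff_thetaHat.differentiable (by simp) q).hasFDerivAt
  have hp := hasFDerivAt_coord q
  have hs := Real.sin_sq_add_cos_sq (q 1)
  ext i
  fin_cases i
  · have := congrArg (fun L => L (Pi.single 2 1)) ((h 0).unique (hp 2).sin.neg)
    simp at this
    simp [this, rHat, phiHat]; linear_combination Real.cos (q 2) * hs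
  · have := congrArg (fun L => L (Pi.single 2 1)) ((h 1).unique (hp 2).cos)
    simp at this
    simp [this, rHat, phiHat]; linear_combination Real.sin (q 2) * hs
  · have := congrArg (fun L => L (Pi.single 2 1)) ((h 2).unique (hasFDerivAt_const (0 : ℝ) q))
    simp at this
    simp [this, rHat, phiHat]; ring

/-- The spherical frame is complete: every vector is the sum of its components along it. -/
theorem eq_sum_frame (q v : Vec) :
    v = (rHat q ⬝ᵥ v) • rHat q + (phiHat q ⬝ᵥ v) • phiHat q + (thetaHat q ⬝ᵥ v) • thetaHat q := by
  have h1 := Real.sin_sq_add_cos_sq (q 1)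
  have h2 := Real.sin_sq_add_cos_sq (q 2)
  ext i
  fin_cases i <;>
    simp [rHat, phiHat, thetaHat, dotProduct, Fin.sum_univ_three] <;>
    generalize Real.sin (q 1) = s at * <;> generalize Real.cos (q 1) = c at * <;>
    generalize Real.sin (q 2) = S at * <;> generalize Real.cos (q 2) = C at *
  · linear_combination (-C * (C * v 0 + S * v 1)) * h1 - v 0 * h2
  · linear_combination (-S * (C * v 0 + S * v 1)) * h1 - v 1 * h2
  · linear_combination (-v 2) * h1

/-- The trace of a linear map, computed in the spherical frame. -/
theorem trace_eq_frame (q : Vec) (M : Vec →L[ℝ] Vec) :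
    rHat q ⬝ᵥ M (rHat q) + phiHat q ⬝ᵥ M (phiHat q) + thetaHat q ⬝ᵥ M (thetaHat q) =
      ∑ i, M (Pi.single i 1) i := by
  have h (i : Fin 3) := congrArg (fun v => M v i) (eq_sum_frame q (Pi.single i 1))
  simp only [Fin.sum_univ_three, h]
  simp [dotProduct, Fin.sum_univ_three]
  ring

theorem rHat_cross_phiHat (q : Vec) : crossProduct (rHat q) (phiHat q) = thetaHat q := by
  have h1 := Real.sin_sq_add_cos_sq (q 1)
  rw [cross_apply]
  ext i
  fin_cases i <;> simp [rHat, phiHat, thetaHat]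
  · linear_combination (-Real.sin (q 2)) * h1
  · linear_combination (Real.cos (q 2)) * h1
  · ring

theorem rHat_cross_thetaHat (q : Vec) : crossProduct (rHat q) (thetaHat q) = -phiHat q := by
  have h2 := Real.sin_sq_add_cos_sq (q 2)
  rw [cross_apply]
  ext i
  fin_cases i <;> simp [rHat, phiHat, thetaHat]
  linear_combination Real.sin (q 1) * h2

/-- The spherical parametrization is a local diffeomorphism off the axis. -/
theorem exists_hasFDerivAt_sph_equiv {q : Vec} (h0 : q 0 ≠ 0) (h1 : Real.sin (q 1) ≠ 0) :
    ∃ e : Vec ≃L[ℝ] Vec, HasFDerivAt sph (e : Vec →L[ℝ] Vec) q := by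
  -- the inverse of the derivative divides the frame components by the scale factors
  let N : Vec →ₗ[ℝ] Vec :=
    { toFun := fun v => ![rHat q ⬝ᵥ v, (q 0)⁻¹ * (phiHat q ⬝ᵥ v),
        (q 0 * Real.sin (q 1))⁻¹ * (thetaHat q ⬝ᵥ v)]
      map_add' := fun v w => by
        ext i; fin_cases i <;> simp [dotProduct_add, mul_add]
      map_smul' := fun c v => by
        ext i; fin_cases i <;> simp [dotProduct_smul, mul_left_comm] }
  have hr : Function.RightInverse N (fderiv ℝ sph q) := fun v => by
    rw [fderiv_sph]
    conv_rhs => rw [eq_sum_frame q v]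
    simp [N]
    congr 2 <;> field_simp
  have hsurj : Function.Surjective (fderiv ℝ sph q : Vec →ₗ[ℝ] Vec) := hr.surjective
  have hinj := LinearMap.injective_iff_surjective.2 hsurj
  refine ⟨(LinearEquiv.ofBijective (fderiv ℝ sph q : Vec →ₗ[ℝ] Vec)
    ⟨hinj, hsurj⟩).toContinuousLinearEquiv, ?_⟩
  exact (contDiff_sph.differentiable (by simp) q).hasFDerivAt

theorem sph_mem_offAxis {q : Vec} (h0 : q 0 ≠ 0) (h1 : Real.sin (q 1) ≠ 0) :
    sph q ∈ offAxis := by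
  have h2 := Real.sin_sq_add_cos_sq (q 2)
  have : sph q 0 ^ 2 + sph q 1 ^ 2 = (q 0 * Real.sin (q 1)) ^ 2 := by
    simp [sph, sphericalPoint]
    linear_combination (q 0 * Real.sin (q 1)) ^ 2 * h2
  change sph q 0 ^ 2 + sph q 1 ^ 2 ≠ 0
  rw [this]
  positivity

/-- Every point off the axis has spherical coordinates. -/
theorem exists_sph_eq {x : Vec} (hx : x ∈ offAxis) :
    ∃ q : Vec, 0 < q 0 ∧ q 1 ∈ Set.Ioo 0 Real.pi ∧ sph q = x := by
  have hx0 : x 0 ^ 2 + x 1 ^ 2 ≠ 0 := hx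
  -- the azimuth is the argument of `x₁ + i x₂`, the polar angle that of `x₃ + i √(x₁² + x₂²)`
  let z : ℂ := ⟨x 0, x 1⟩
  let w : ℂ := ⟨x 2, ‖z‖⟩
  have hz : 0 < ‖z‖ := by
    rw [norm_pos_iff]
    rintro h
    have e0 : x 0 = 0 := congrArg Complex.re h
    have e1 : x 1 = 0 := congrArg Complex.im h
    simp [e0, e1] at hx0
  have hw : w ≠ 0 := fun h => hz.ne' (congrArg Complex.im h)
  have e0 : ‖z‖ * Real.cos z.arg = x 0 := Complex.norm_mul_cos_arg z
  have e1 : ‖z‖ * Real.sin z.arg = x 1 := Complex.norm_mul_sin_arg z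
  have e2 : ‖w‖ * Real.cos w.arg = x 2 := Complex.norm_mul_cos_arg w
  have e3 : ‖w‖ * Real.sin w.arg = ‖z‖ := Complex.norm_mul_sin_arg w
  have hwn : 0 < ‖w‖ := norm_pos_iff.2 hw
  have hsin : 0 < Real.sin w.arg := by
    by_contra! h
    nlinarith
  have h0 : 0 ≤ w.arg := Complex.arg_nonneg_iff.2 hz.le
  refine ⟨![‖w‖, w.arg, z.arg], hwn, ⟨lt_of_le_of_ne h0 ?_, lt_of_le_of_ne (Complex.arg_le_pi w) ?_⟩,
    ?_⟩
  · intro h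
    rw [← show 0 = w.arg from h] at hsin
    simp at hsin
  · intro h
    rw [show w.arg = Real.pi from h] at hsin
    simp at hsin
  · ext i
    fin_cases i
    · simp [sph, sphericalPoint, e3, e0]
    · simp [sph, sphericalPoint, e3, e1]
    · simp [sph, sphericalPoint, e2]

/-- Spherical coordinates are unique once the azimuth ranges over an interval of length `2π`. -/
theorem injOn_sph (α : ℝ) : Set.InjOn sph {q | 0 < q 0 ∧ q 1 ∈ Set.Ioo 0 Real.pi ∧
    q 2 ∈ Set.Ioo α (α + 2 * Real.pi)} := by
  rintro p ⟨hp0, hp1, hp2⟩ q ⟨hq0, hq1, hq2⟩ h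
  have hn (q : Vec) : normSq (sph q) = q 0 ^ 2 := by
    have h1 := Real.sin_sq_add_cos_sq (q 1)
    have h2 := Real.sin_sq_add_cos_sq (q 2)
    simp [normSq_eq, sph, sphericalPoint]
    linear_combination (q 0) ^ 2 * (Real.sin (q 1)) ^ 2 * h2 + q 0 ^ 2 * h1
  have e0 : p 0 = q 0 := by
    have := congrArg normSq h
    rw [hn, hn] at this
    exact (pow_left_inj₀ hp0.le hq0.le two_ne_zero).1 this
  have c0 : p 0 * Real.sin (p 1) * Real.cos (p 2) = q 0 * Real.sin (q 1) * Real.cos (q 2) :=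
    congrFun h 0
  have c1 : p 0 * Real.sin (p 1) * Real.sin (p 2) = q 0 * Real.sin (q 1) * Real.sin (q 2) :=
    congrFun h 1
  have c2 : p 0 * Real.cos (p 1) = q 0 * Real.cos (q 1) := congrFun h 2
  have e1 : p 1 = q 1 := by
    rw [e0] at c2
    exact Real.injOn_cos (Set.Ioo_subset_Icc_self hp1) (Set.Ioo_subset_Icc_self hq1)
      (mul_left_cancel₀ hq0.ne' c2)
  have hs : q 0 * Real.sin (q 1) ≠ 0 := (mul_pos hq0 (Real.sin_pos_of_mem_Ioo hq1)).ne'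
  rw [e0, e1] at c0 c1
  obtain ⟨k, hk⟩ := Real.Angle.angle_eq_iff_two_pi_dvd_sub.1
    (Real.Angle.cos_sin_inj (mul_left_cancel₀ hs c0) (mul_left_cancel₀ hs c1))
  have hpi := Real.pi_pos
  have hk0 : k = 0 := by
    have h1 : (k : ℝ) < 1 := by
      by_contra! hle
      nlinarith [hp2.1, hp2.2, hq2.1, hq2.2]
    have h2 : (-1 : ℝ) < k := by
      by_contra! hle
      nlinarith [hp2.1, hp2.2, hq2.1, hq2.2]
    have h1' : k < 1 := by exact_mod_cast h1
    have h2' : -1 < k := by exact_mod_cast h2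
    omega
  have e2 : p 2 = q 2 := by
    rw [hk0] at hk
    simpa [sub_eq_zero] using hk
  ext i
  fin_cases i
  exacts [e0, e1, e2]

/-! ### Tangential divergence-free fields have a stream function -/

section Potential

variable {Ω : Set Vec}

theorem sph_map_nhds {q : Vec} (h0 : 0 < q 0) (h1 : q 1 ∈ Set.Ioo 0 Real.pi) :
    Filter.map sph (𝓝 q) = 𝓝 (sph q) := by
  obtain ⟨e, he⟩ := exists_hasFDerivAt_sph_equiv h0.ne' (Real.sin_pos_of_mem_Ioo h1).ne'
  exact HasStrictFDerivAt.map_nhds_eq_of_equiv (f' := e)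
    (contDiff_sph.contDiffAt.hasStrictFDerivAt' he (by simp))

theorem isOpen_image_sph (hΩ : IsOpen Ω)
    (hpos : ∀ q ∈ Ω, 0 < q 0 ∧ q 1 ∈ Set.Ioo 0 Real.pi) : IsOpen (sph '' Ω) := by
  rw [isOpen_iff_mem_nhds]
  rintro _ ⟨q, hq, rfl⟩
  rw [← sph_map_nhds (hpos q hq).1 (hpos q hq).2]
  exact Filter.image_mem_map (hΩ.mem_nhds hq)

theorem image_sph_subset_offAxis (hpos : ∀ q ∈ Ω, 0 < q 0 ∧ q 1 ∈ Set.Ioo 0 Real.pi) :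
    sph '' Ω ⊆ offAxis := by
  rintro _ ⟨q, hq, rfl⟩
  exact sph_mem_offAxis (hpos q hq).1.ne' (Real.sin_pos_of_mem_Ioo (hpos q hq).2).ne'

/-- A smooth function of the spherical coordinates is a smooth function of the point. -/
theorem exists_comp_sph_eq (hΩ : IsOpen Ω)
    (hpos : ∀ q ∈ Ω, 0 < q 0 ∧ q 1 ∈ Set.Ioo 0 Real.pi) (hinj : Set.InjOn sph Ω)
    {Ψ : Vec → ℝ} (hΨ : ContDiffOn ℝ ∞ Ψ Ω) :
    ∃ W : Vec → ℝ, ContDiffOn ℝ ∞ W (sph '' Ω) ∧ ∀ q ∈ Ω, W (sph q) = Ψ q := by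
  refine ⟨Ψ ∘ Function.invFunOn sph Ω, ?_, fun q hq => by simp [hinj.leftInvOn_invFunOn hq]⟩
  rintro _ ⟨q, hq, rfl⟩
  obtain ⟨e, he⟩ := exists_hasFDerivAt_sph_equiv (hpos q hq).1.ne'
    (Real.sin_pos_of_mem_Ioo (hpos q hq).2).ne'
  have hc : ContDiffAt ℝ ∞ sph q := contDiff_sph.contDiffAt
  have hs : HasStrictFDerivAt sph (e : Vec →L[ℝ] Vec) q := hc.hasStrictFDerivAt' he (by simp)
  have hQ := hc.to_localInverse he (by simp)
  have hQq : hc.localInverse he (by simp) (sph q) = q := hc.localInverse_apply_image he (by simp)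
  have hΨq : ContDiffAt ℝ ∞ Ψ (hc.localInverse he (by simp) (sph q)) := by
    rw [hQq]; exact hΨ.contDiffAt (hΩ.mem_nhds hq)
  have hmem : ∀ᶠ y in 𝓝 (sph q), hc.localInverse he (by simp) y ∈ Ω :=
    hQ.continuousAt.eventually_mem (by rw [hQq]; exact hΩ.mem_nhds hq)
  have hright : ∀ᶠ y in 𝓝 (sph q), sph (hc.localInverse he (by simp) y) = y :=
    hs.eventually_right_inverse
  refine ((hΨq.comp (sph q) hQ).congr_of_eventuallyEq ?_).contDiffWithinAt
  filter_upwards [hmem, hright] with y hy1 hy2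
  simp only [Function.comp_apply]
  conv_lhs => rw [← hy2]
  rw [hinj.leftInvOn_invFunOn hy1]

/-- On a region that is convex in spherical coordinates, a tangential divergence-free field is
`x × grad W`. On each sphere such a field is the rotated gradient of a stream function `W`: in
angular coordinates the equations for `W` read `∂W/∂φ = h · θ̂` and `∂W/∂θ = - sin φ (h · φ̂)`, and
their integrability condition is `div h = 0`. The Poincaré lemma with the radius as parameter gives
`W` on all spheres at once. -/
theorem exists_eq_cross_grad (hΩ : IsOpen Ω) (hconv : Convex ℝ Ω)
    (hpos : ∀ q ∈ Ω, 0 < q 0 ∧ q 1 ∈ Set.Ioo 0 Real.pi) (hinj : Set.InjOn sph Ω)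
    (q₀ : Vec) (hq₀ : ∀ q ∈ Ω, ![q 0, q₀ 1, q₀ 2] ∈ Ω)
    {h : Vec → Vec} (hh : IsSolutionOn 0 (sph '' Ω) h) :
    ∃ W : Vec → ℝ, ContDiffOn ℝ ∞ W (sph '' Ω) ∧
      ∀ x ∈ sph '' Ω, h x = crossProduct x (grad W x) := by
  have hU := isOpen_image_sph hΩ hpos
  have hUa := image_sph_subset_offAxis hpos
  have hhΩ : ContDiffOn ℝ ∞ (fun q => h (sph q)) Ω :=
    hh.1.comp contDiff_sph.contDiffOn (Set.mapsTo_image _ _)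
  have hhd : ∀ q ∈ Ω, HasFDerivAt (fun q => h (sph q))
      ((fderiv ℝ h (sph q)).comp (fderiv ℝ sph q)) q := fun q hq =>
    HasFDerivAt.comp (g := h) q ((hh.1.contDiffAt
      (hU.mem_nhds (Set.mem_image_of_mem _ hq))).differentiableAt (by simp)).hasFDerivAt
      (contDiff_sph.differentiable (by simp) q).hasFDerivAt
  have hrad : ∀ q ∈ Ω, rHat q ⬝ᵥ h (sph q) = 0 := by
    intro q hq
    have := (hh.2 _ (Set.mem_image_of_mem _ hq)).2
    rw [sph_eq, smul_dotProduct, ← sph_eq] at this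
    simpa [(hpos q hq).1.ne'] using this
  -- the radial part of the trace of `Dh` vanishes because `h` is tangential
  have htan : ∀ q ∈ Ω, phiHat q ⬝ᵥ fderiv ℝ h (sph q) (phiHat q) +
      thetaHat q ⬝ᵥ fderiv ℝ h (sph q) (thetaHat q) = 0 := by
    intro q hq
    have h1 := hh.dotProduct_fderiv hU hUa (contDiffOn_const (c := (0 : ℝ)))
      (Set.mem_image_of_mem _ hq) (rHat q)
    have h0 : deriv (0 : ℝ → ℝ) (normSq (sph q)) = 0 := by simp
    rw [hrad q hq, h0] at h1
    have h2 : rHat q ⬝ᵥ fderiv ℝ h (sph q) (rHat q) = 0 := by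
      rw [show sph q ⬝ᵥ fderiv ℝ h (sph q) (rHat q) =
        q 0 * (rHat q ⬝ᵥ fderiv ℝ h (sph q) (rHat q)) by
          conv_lhs => enter [1]; rw [sph_eq]
          simp] at h1
      simpa [(hpos q hq).1.ne'] using h1
    have h3 := (hh.2 _ (Set.mem_image_of_mem _ hq)).1
    rw [h0, divergence, ← trace_eq_frame q, h2] at h3
    linarith
  let a : Vec → ℝ := fun q => thetaHat q ⬝ᵥ h (sph q)
  let b : Vec → ℝ := fun q => -Real.sin (q 1) * (phiHat q ⬝ᵥ h (sph q))
  have hdot {v : Vec → Vec} (hv : ContDiff ℝ ∞ v) :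
      ContDiffOn ℝ ∞ (fun q => v q ⬝ᵥ h (sph q)) Ω := by
    simp only [dotProduct]
    exact ContDiffOn.sum fun i _ =>
      (contDiffOn_pi.1 hv.contDiffOn i).mul (contDiffOn_pi.1 hhΩ i)
  have ha : ContDiffOn ℝ ∞ a Ω := hdot contDiff_thetaHat
  have hb : ContDiffOn ℝ ∞ b Ω :=
    ContDiffOn.mul (by fun_prop) (hdot contDiff_phiHat)
  have hab : ∀ q ∈ Ω, fderiv ℝ a q (Pi.single 2 1) = fderiv ℝ b q (Pi.single 1 1) := by
    intro q hq
    obtain ⟨A, hA, hA'⟩ := hasFDerivAt_dotProduct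
      (contDiff_thetaHat.differentiable (by simp) q).hasFDerivAt (hhd q hq)
    obtain ⟨B, hB, hB'⟩ := hasFDerivAt_dotProduct
      (contDiff_phiHat.differentiable (by simp) q).hasFDerivAt (hhd q hq)
    have hB2 : HasFDerivAt b _ q := (hasFDerivAt_coord q 1).sin.fun_neg.fun_mul hB
    have e1 := hrad q hq
    have e2 := htan q hq
    rw [show fderiv ℝ a q = A from hA.fderiv, hB2.fderiv, hA', fderiv_thetaHat_single_two]
    simp [hB', fderiv_phiHat_single_one, fderiv_sph, add_dotProduct, e1]
    linear_combination (q 0 * Real.sin (q 1)) * e2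
  let p (i : Fin 3) : Vec →L[ℝ] ℝ := ContinuousLinearMap.proj i
  let η : Vec → Vec →L[ℝ] ℝ := fun q => a q • p 1 + b q • p 2
  have hη : ContDiffOn ℝ ∞ η Ω :=
    (ha.smul contDiffOn_const).add (hb.smul contDiffOn_const)
  let L : Vec →L[ℝ] Vec :=
    (p 1).smulRight (Pi.single 1 1) + (p 2).smulRight (Pi.single 2 1)
  have hLapply (u : Vec) : L u = u 1 • Pi.single 1 1 + u 2 • Pi.single 2 1 := by simp [L, p]
  obtain ⟨Ψ, hΨ, hΨ'⟩ := exists_primitive_along hΩ hconv L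
    (fun u => by simp only [hLapply]; simp) q₀
    (fun q hq => by
      convert hq₀ q hq using 1
      ext i
      rw [hLapply]
      fin_cases i <;> simp) hη
    (fun q hq u v => by
      have hda := ((ha.contDiffAt (hΩ.mem_nhds hq)).differentiableAt (by simp)).hasFDerivAt
      have hdb := ((hb.contDiffAt (hΩ.mem_nhds hq)).differentiableAt (by simp)).hasFDerivAt
      have hdη : HasFDerivAt η _ q := (hda.smul_const (p 1)).add (hdb.smul_const (p 2))
      have := hab q hq
      rw [hdη.fderiv]
      simp [hLapply, p]
      linear_combination (u 2 * v 1 - u 1 * v 2) * this)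
  obtain ⟨W, hW, hWΨ⟩ := exists_comp_sph_eq hΩ hpos hinj hΨ
  refine ⟨W, hW, ?_⟩
  rintro _ ⟨q, hq, rfl⟩
  have hWd := ((hW.contDiffAt (hU.mem_nhds (Set.mem_image_of_mem _ hq))).differentiableAt
    (by simp)).hasFDerivAt
  have hcomp : HasFDerivAt (fun q => W (sph q)) _ q :=
    HasFDerivAt.comp (g := W) q hWd (contDiff_sph.differentiable (by simp) q).hasFDerivAt
  have heq : (fun q => W (sph q)) =ᶠ[𝓝 q] Ψ :=
    Filter.eventuallyEq_of_mem (hΩ.mem_nhds hq) hWΨ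
  have hchain (u : Vec) : fderiv ℝ Ψ q u = grad W (sph q) ⬝ᵥ fderiv ℝ sph q u := by
    rw [← heq.fderiv_eq, hcomp.fderiv, dotProduct_grad]; rfl
  have hr := (hpos q hq).1
  have hs := Real.sin_pos_of_mem_Ioo (hpos q hq).2
  have eφ : q 0 * (phiHat q ⬝ᵥ grad W (sph q)) = thetaHat q ⬝ᵥ h (sph q) := by
    have := hΨ' q hq (Pi.single 1 1)
    rw [hchain, fderiv_sph, hLapply] at this
    simpa [η, a, b, p, dotProduct_comm (grad W (sph q))] using this
  have eθ : q 0 * (thetaHat q ⬝ᵥ grad W (sph q)) = -(phiHat q ⬝ᵥ h (sph q)) := by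
    have := hΨ' q hq (Pi.single 2 1)
    rw [hchain, fderiv_sph, hLapply] at this
    simp [η, a, b, p, dotProduct_comm (grad W (sph q))] at this
    refine mul_left_cancel₀ hs.ne' ?_
    linear_combination this
  conv_lhs => rw [eq_sum_frame q (h (sph q)), hrad q hq, ← eφ,
    ← neg_eq_iff_eq_neg.2 eθ]
  conv_rhs => rw [eq_sum_frame q (grad W (sph q))]
  conv_rhs => enter [1]; rw [sph_eq]
  simp only [map_add, map_smul, LinearMap.smul_apply, rHat_cross_phiHat, rHat_cross_thetaHat,
    cross_self]
  module

end Potential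

/-! ### Solutions have the general form -/

section

variable {U : Set Vec} {β : ℝ → ℝ} {g : Vec → Vec}

theorem IsSphericalBox.hasGeneralFormOn (hbox : IsSphericalBox U) (hU : IsOpen U)
    (hUa : U ⊆ offAxis) (hβ : ContDiffOn ℝ ∞ β (normSq '' U)) (hg : IsSolutionOn β U g) :
    HasGeneralFormOn β U g := by
  obtain ⟨I, J, K, α, hI, hIc, hI0, hJ, hJc, hJ0, hK, hKc, hK0, hUeq⟩ := hbox
  rcases U.eq_empty_or_nonempty with rfl | hne
  · exact ⟨0, 0, contDiffOn_empty, contDiffOn_empty, by simp⟩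
  let Ω : Set Vec := {q | q 0 ∈ I ∧ q 1 ∈ J ∧ q 2 ∈ K}
  have himage : U = sph '' Ω := by
    rw [hUeq]
    ext x
    constructor
    · rintro ⟨r, hr, φ, hφ, θ, hθ, rfl⟩
      exact ⟨![r, φ, θ], ⟨hr, hφ, hθ⟩, rfl⟩
    · rintro ⟨q, ⟨h0, h1, h2⟩, rfl⟩
      exact ⟨_, h0, _, h1, _, h2, rfl⟩
  have hΩ : IsOpen Ω :=
    (hI.preimage (continuous_apply 0)).inter
      ((hJ.preimage (continuous_apply 1)).inter (hK.preimage (continuous_apply 2)))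
  have hconv : Convex ℝ Ω := fun x hx y hy a b ha hb hab =>
    ⟨hIc.convex hx.1 hy.1 ha hb hab, hJc.convex hx.2.1 hy.2.1 ha hb hab,
      hKc.convex hx.2.2 hy.2.2 ha hb hab⟩
  have hpos : ∀ q ∈ Ω, 0 < q 0 ∧ q 1 ∈ Set.Ioo 0 Real.pi := fun q hq => ⟨hI0 hq.1, hJ0 hq.2.1⟩
  have hinj : Set.InjOn sph Ω :=
    (injOn_sph α).mono fun q hq => by exact ⟨hI0 hq.1, hJ0 hq.2.1, hK0 hq.2.2⟩
  have hh := hg.sub_smul_fField hU hUa hβ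
  rw [himage] at hh hne
  obtain ⟨q₀, hq₀⟩ := hne.of_image
  obtain ⟨W, hW, hW'⟩ := exists_eq_cross_grad hΩ hconv hpos hinj q₀
    (fun q hq => ⟨hq.1, hq₀.2.1, hq₀.2.2⟩) hh
  rw [← himage] at hW hW'
  -- on a box the stream function absorbs every term `F n`, so `F = 0` suffices
  refine ⟨W, 0, hW, contDiffOn_const (c := (0 : ℝ)), fun x hx => ?_⟩
  rw [Pi.zero_apply, Pi.zero_apply, zero_smul, add_zero, ← hW' x hx]
  simp

/-- Every point off the axis has arbitrarily small spherical boxes as neighbourhoods. -/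
theorem exists_isSphericalBox_subset (hU : IsOpen U) (hUa : U ⊆ offAxis) {x : Vec} (hx : x ∈ U) :
    ∃ V ⊆ U, IsOpen V ∧ x ∈ V ∧ IsSphericalBox V := by
  obtain ⟨q, h0, h1, rfl⟩ := exists_sph_eq (hUa hx)
  have hpre : sph ⁻¹' U ∩ {y | 0 < y 0 ∧ y 1 ∈ Set.Ioo 0 Real.pi ∧
      y 2 ∈ Set.Ioo (q 2 - Real.pi) (q 2 - Real.pi + 2 * Real.pi)} ∈ 𝓝 q := by
    have hpi := Real.pi_pos
    refine (IsOpen.inter (hU.preimage contDiff_sph.continuous)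
      ((isOpen_Ioi.preimage (continuous_apply 0)).inter
      ((isOpen_Ioo.preimage (continuous_apply 1)).inter
        (isOpen_Ioo.preimage (continuous_apply 2))))).mem_nhds ⟨hx, h0, h1, ?_⟩
    constructor <;> linarith
  obtain ⟨ε, hε, hball⟩ := Metric.mem_nhds_iff.1 hpre
  have hmem (r φ θ : ℝ) (hr : r ∈ Metric.ball (q 0) ε) (hφ : φ ∈ Metric.ball (q 1) ε)
      (hθ : θ ∈ Metric.ball (q 2) ε) : ![r, φ, θ] ∈ Metric.ball q ε := by
    rw [Metric.mem_ball, dist_pi_lt_iff hε]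
    intro i
    fin_cases i
    exacts [hr, hφ, hθ]
  have hself (i : Fin 3) : q i ∈ Metric.ball (q i) ε := Metric.mem_ball_self hε
  have himage : {x | ∃ r ∈ Metric.ball (q 0) ε, ∃ φ ∈ Metric.ball (q 1) ε,
      ∃ θ ∈ Metric.ball (q 2) ε, x = sphericalPoint r φ θ} = sph '' Metric.ball q ε := by
    ext x
    constructor
    · rintro ⟨r, hr, φ, hφ, θ, hθ, rfl⟩
      exact ⟨_, hmem r φ θ hr hφ hθ, rfl⟩
    · rintro ⟨y, hy, rfl⟩
      rw [Metric.mem_ball, dist_pi_lt_iff hε] at hy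
      exact ⟨_, hy 0, _, hy 1, _, hy 2, rfl⟩
  refine ⟨sph '' Metric.ball q ε, ?_, ?_, ⟨q, Metric.mem_ball_self hε, rfl⟩, ?_⟩
  · rintro _ ⟨y, hy, rfl⟩
    exact (hball hy).1
  · exact isOpen_image_sph Metric.isOpen_ball fun y hy => ⟨(hball hy).2.1, (hball hy).2.2.1⟩
  · exact ⟨Metric.ball (q 0) ε, Metric.ball (q 1) ε, Metric.ball (q 2) ε, q 2 - Real.pi,
      Metric.isOpen_ball, (convex_ball _ _).ordConnected,
      fun r hr => (hball (hmem r _ _ hr (hself 1) (hself 2))).2.1,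
      Metric.isOpen_ball, (convex_ball _ _).ordConnected,
      fun φ hφ => (hball (hmem _ φ _ (hself 0) hφ (hself 2))).2.2.1,
      Metric.isOpen_ball, (convex_ball _ _).ordConnected,
      fun θ hθ => (hball (hmem _ _ θ (hself 0) (hself 1) hθ)).2.2.2, himage.symm⟩

theorem IsSolutionOn.mono {V : Set Vec} (hg : IsSolutionOn β U g) (h : V ⊆ U) :
    IsSolutionOn β V g :=
  ⟨hg.1.mono h, fun x hx => hg.2 x (h hx)⟩

theorem isSolutionOn_of_locally
    (h : ∀ p ∈ U, ∃ V ⊆ U, IsOpen V ∧ p ∈ V ∧ IsSolutionOn β V g) : IsSolutionOn β U g := by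
  constructor
  · intro p hp
    obtain ⟨V, -, hV, hpV, hg⟩ := h p hp
    exact (hg.1.contDiffAt (hV.mem_nhds hpV)).contDiffWithinAt
  · intro p hp
    obtain ⟨V, -, -, hpV, hg⟩ := h p hp
    exact hg.2 p hpV

/-! ### The shift is a canonical transformation -/

/-- The Poisson property of the shift reduces to `(tr M - Mᵀ) x = g` with `M = Dg`, which holds
because `Mᵀ x = 2 β' x - g` is the derivative of `x · g = β(A)` and `tr M = 2 β'`. -/
theorem IsSolutionOn.bracket_comp_shift (hg : IsSolutionOn β U g) (hU : IsOpen U)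
    (hUa : U ⊆ offAxis) (hβ : ContDiffOn ℝ ∞ β (normSq '' U)) {Φ Ψ : Phase → ℝ} {p : Phase}
    (hp : p.1 ∈ U) (hΦ : DifferentiableAt ℝ Φ (shift g p))
    (hΨ : DifferentiableAt ℝ Ψ (shift g p)) :
    bracket (Φ ∘ shift g) (Ψ ∘ shift g) p = bracket Φ Ψ (shift g p) := by
  obtain ⟨x, J⟩ := p
  set M := fderiv ℝ g x with hM
  have hd : HasFDerivAt g M x :=
    ((hg.1.contDiffAt (hU.mem_nhds hp)).differentiableAt (by simp)).hasFDerivAt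
  have hshift : HasFDerivAt (shift g) ((ContinuousLinearMap.fst ℝ Vec Vec).prod
      (ContinuousLinearMap.snd ℝ Vec Vec + M.comp (ContinuousLinearMap.fst ℝ Vec Vec))) (x, J) := by
    have h1 : HasFDerivAt (fun p : Phase => g p.1) (M.comp (ContinuousLinearMap.fst ℝ Vec Vec))
        (x, J) := HasFDerivAt.comp (g := g) (x, J) hd hasFDerivAt_fst
    exact hasFDerivAt_fst.prodMk (hasFDerivAt_snd.fun_add h1)
  have hJ {Φ : Phase → ℝ} (hΦ : DifferentiableAt ℝ Φ (shift g (x, J))) :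
      gradJ (Φ ∘ shift g) (x, J) = gradJ Φ (shift g (x, J)) := by
    ext i
    simp [gradJ, (hΦ.hasFDerivAt.comp (x, J) hshift).fderiv]
  have hX {Φ : Phase → ℝ} (hΦ : DifferentiableAt ℝ Φ (shift g (x, J))) (i : Fin 3) :
      gradX (Φ ∘ shift g) (x, J) i = gradX Φ (shift g (x, J)) i +
        M (Pi.single i 1) ⬝ᵥ gradJ Φ (shift g (x, J)) := by
    have h1 := map_eq_sum_single ((fderiv ℝ Φ (shift g (x, J))).comp
      (ContinuousLinearMap.inr ℝ Vec Vec)) (M (Pi.single i 1))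
    simp only [ContinuousLinearMap.comp_apply, ContinuousLinearMap.inr_apply] at h1
    have h2 : ((Pi.single i 1 : Vec), M (Pi.single i 1)) =
        (Pi.single i 1, 0) + (0, M (Pi.single i 1)) := by simp
    simp [gradX, gradJ, (hΦ.hasFDerivAt.comp (x, J) hshift).fderiv, dotProduct,
      Fin.sum_univ_three]
    rw [h2, map_add, h1]
    simp
  -- `key i` is the `i`-th component of `g + Mᵀ x = 2 β' x`
  have key (i : Fin 3) := hg.dotProduct_fderiv hU hUa hβ hp (Pi.single i 1)
  have htr := (hg.2 x hp).1
  rw [divergence, ← hM] at htr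
  simp only [← hM] at key
  have k0 := key 0
  have k1 := key 1
  have k2 := key 2
  unfold bracket
  rw [hJ hΦ, hJ hΨ]
  simp [dotProduct, Fin.sum_univ_three] at k0 k1 k2 htr
  simp [dotProduct, Fin.sum_univ_three, cross_apply, hX hΦ, hX hΨ, shift]
  generalize gradJ Φ _ = u
  generalize gradJ Ψ _ = w
  linear_combination (-(u 1 * w 2 - u 2 * w 1)) * k0 - (u 2 * w 0 - u 0 * w 2) * k1 -
    (u 0 * w 1 - u 1 * w 0) * k2 + (x 0 * (u 1 * w 2 - u 2 * w 1) + x 1 * (u 2 * w 0 - u 0 * w 2) +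
    x 2 * (u 0 * w 1 - u 1 * w 0)) * htr

theorem IsSolutionOn.isCanonicalOn_shift (hg : IsSolutionOn β U g) (hU : IsOpen U)
    (hUa : U ⊆ offAxis) (hβ : ContDiffOn ℝ ∞ β (normSq '' U)) :
    IsCanonicalOn (U ×ˢ Set.univ) (shift g) := by
  have hmaps : Set.MapsTo (shift g) (U ×ˢ Set.univ) (U ×ˢ Set.univ) := fun p hp => ⟨hp.1, trivial⟩
  have hopen : IsOpen (U ×ˢ (Set.univ : Set Vec)) := hU.prod isOpen_univ
  refine ⟨hmaps, ?_, fun Φ Ψ hΦ hΨ p hp => ?_⟩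
  · exact contDiffOn_fst.prodMk
      (contDiffOn_snd.add (hg.1.comp contDiffOn_fst fun p hp => hp.1))
  · have hn := hopen.mem_nhds (hmaps hp)
    exact hg.bracket_comp_shift hU hUa hβ hp.1 ((hΦ.contDiffAt hn).differentiableAt (by simp))
      ((hΨ.contDiffAt hn).differentiableAt (by simp))

theorem IsSolutionOn.casimirB_shift (hg : IsSolutionOn β U g) {p : Phase} (hp : p.1 ∈ U) :
    casimirB (shift g p) = casimirB p + β (casimirA p) := by
  simp [casimirB, casimirA, shift, dotProduct_add, (hg.2 _ hp).2]

theorem IsSolutionOn.bijOn_shift (hg : IsSolutionOn β U g) (a b : ℝ) :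
    Set.BijOn (shift g) (leaf a b ∩ U ×ˢ Set.univ) (leaf a (b + β a) ∩ U ×ˢ Set.univ) := by
  refine ⟨?_, ?_, ?_⟩
  · rintro p ⟨⟨hA, hB⟩, hp⟩
    refine ⟨⟨hA, ?_⟩, hp.1, trivial⟩
    rw [hg.casimirB_shift hp.1, hA, hB]
  · rintro ⟨x, J⟩ - ⟨y, K⟩ - h
    obtain ⟨rfl, h2⟩ := Prod.mk.inj h
    exact Prod.ext rfl (add_right_cancel h2)
  · rintro ⟨x, J⟩ ⟨⟨hA, hB⟩, hp⟩
    have hs : shift g (x, J - g x) = (x, J) := by simp [shift]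
    refine ⟨(x, J - g x), ⟨⟨hA, ?_⟩, hp.1, trivial⟩, hs⟩
    have h1 := hg.casimirB_shift (p := (x, J - g x)) hp.1
    rw [hs, hB, show casimirA (x, J - g x) = a from hA] at h1
    linarith

end

end E3

theorem proposition1 (U : Set E3.Vec) (hU : IsOpen U) (hU_axis : U ⊆ E3.offAxis)
    (β : ℝ → ℝ) (hβ : ContDiffOn ℝ ∞ β (E3.normSq '' U)) (g : E3.Vec → E3.Vec) :
    -- every `g` of the stated form is a solution
    (E3.HasGeneralFormOn β U g → E3.IsSolutionOn β U g) ∧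
    -- the solutions are exactly the `g` that are locally of the stated form
    (E3.IsSolutionOn β U g ↔
      ∀ p ∈ U, ∃ V ⊆ U, IsOpen V ∧ p ∈ V ∧ E3.HasGeneralFormOn β V g) ∧
    -- on a spherical box, the form is global
    (E3.IsSphericalBox U → (E3.IsSolutionOn β U g ↔ E3.HasGeneralFormOn β U g)) ∧
    -- the shift by a solution is canonical and changes the Casimir functions as stated
    (E3.IsSolutionOn β U g →
      E3.IsCanonicalOn (U ×ˢ Set.univ) (E3.shift g) ∧
      (∀ p ∈ U ×ˢ (Set.univ : Set E3.Vec),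
        E3.casimirA (E3.shift g p) = E3.casimirA p ∧
        E3.casimirB (E3.shift g p) = E3.casimirB p + β (E3.casimirA p)) ∧
      ∀ a b : ℝ, Set.BijOn (E3.shift g)
        (E3.leaf a b ∩ U ×ˢ Set.univ) (E3.leaf a (b + β a) ∩ U ×ˢ Set.univ)) := by
  have hβV {V : Set E3.Vec} (hV : V ⊆ U) : ContDiffOn ℝ ∞ β (E3.normSq '' V) :=
    hβ.mono (Set.image_mono hV)
  refine ⟨E3.isSolutionOn_of_hasGeneralFormOn hU hU_axis hβ, ⟨fun hg p hp => ?_, fun h => ?_⟩,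
    fun hbox => ⟨hbox.hasGeneralFormOn hU hU_axis hβ,
      E3.isSolutionOn_of_hasGeneralFormOn hU hU_axis hβ⟩,
    fun hg => ⟨hg.isCanonicalOn_shift hU hU_axis hβ,
      fun p hp => ⟨rfl, hg.casimirB_shift hp.1⟩, hg.bijOn_shift⟩⟩
  · obtain ⟨V, hVU, hV, hpV, hbox⟩ := E3.exists_isSphericalBox_subset hU hU_axis hp
    exact ⟨V, hVU, hV, hpV,
      hbox.hasGeneralFormOn hV (hVU.trans hU_axis) (hβV hVU) (hg.mono hVU)⟩
  · refine E3.isSolutionOn_of_locally fun p hp => ?_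
    obtain ⟨V, hVU, hV, hpV, hg⟩ := h p hp
    exact ⟨V, hVU, hV, hpV,
      E3.isSolutionOn_of_hasGeneralFormOn hV (hVU.trans hU_axis) (hβV hVU) hg⟩
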